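/- **Theorem (Uniqueness).** Let $\Omega=(0,1)\times(0,1)$, let $\varphi\in L^1(0,1)$ be nonzero (i.e. not a.e. equal to $0$), and let $g_0,g_1\in L^2(\Omega)$; all functions are real-valued. For $i=1,2$ let $$u_i\in C^1([0,1];L^2(\Omega))\cap L^2(0,1;H^2(\Omega)),\qquad f_i\in L^2(\Omega),$$ and suppose that both pairs $(u,f)=(u_1,f_1)$ and $(u,f)=(u_2,f_2)$ satisfy $$\begin{cases} u_t-\Delta u=\varphi(t)f(x,y), & t\in(0,1),\ (x,y)\in\Omega,\\ u_x(0,y,t)=u_x(1,y,t)=u_y(x,0,t)=u_y(x,1,t)=0, & t\in(0,1),\ x,y\in(0,1),\\ u(1,y,t)=0, & t\in(0,1),\ y\in(0,1),\end{cases}$$ together with $$u(x,y,0)=g_0(x,y),\qquad u(x,y,1)=g_1(x,y),\qquad (x,y)\in\Omega.$$ Here the equation is an identity in $L^2(\Omega)$ for almost every $t\in(0,1)$, the boundary conditions hold for almost every $t\in(0,1)$ in the sense of traces on the sides of the square of $u(\cdot,\cdot,t)\in H^2(\Omega)$ and of its first weak derivatives, and the conditions at $t=0$ and $t=1$ are identities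 in $L^2(\Omega)$. Then $(u_1,f_1)=(u_2,f_2)$, that is, $u_1(\cdot,\cdot,t)=u_2(\cdot,\cdot,t)$ in $L^2(\Omega)$ for every $t\in[0,1]$, and $f_1=f_2$ in $L^2(\Omega)$. -/

import Mathlib

open Set MeasureTheory Filter Topology
open scoped ContDiff ENNReal

noncomputable section

namespace HeatSource

/-- The open unit square `Ω = (0,1) × (0,1)`. -/
def Ω : Set (ℝ × ℝ) := Ioo (0 : ℝ) 1 ×ˢ Ioo (0 : ℝ) 1

/-- Lebesgue measure on `Ω`. -/
abbrev μΩ : Measure (ℝ × ℝ) := volume.restrict Ω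

/-- Lebesgue measure on the interval `(0,1)`. -/
abbrev μI : Measure ℝ := volume.restrict (Ioo (0 : ℝ) 1)

/-- The real Hilbert space `L²(Ω)`. -/
abbrev L2Ω : Type := Lp ℝ 2 μΩ

/-- The coordinate directions of the plane: `0` is the `x`-direction, `1` the `y`-direction. -/
def dir (i : Fin 2) : ℝ × ℝ := if i = 0 then (1, 0) else (0, 1)

/-- The classical partial derivative `∂ᵢψ`. -/
def partialDeriv (i : Fin 2) (ψ : ℝ × ℝ → ℝ) : ℝ × ℝ → ℝ := fun p => fderiv ℝ ψ p (dir i)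

/-- `w ∈ L²(Ω)` is the weak partial derivative `∂ᵢv` of `v ∈ L²(Ω)`:
`∫_Ω v ∂ᵢψ = - ∫_Ω w ψ` for all test functions `ψ ∈ C_c^∞(Ω)`. -/
def HasWeakPartial (i : Fin 2) (v w : L2Ω) : Prop :=
  ∀ ψ : ℝ × ℝ → ℝ, ContDiff ℝ ∞ ψ → HasCompactSupport ψ → tsupport ψ ⊆ Ω →
    ∫ p, v p * partialDeriv i ψ p ∂μΩ = - ∫ p, w p * ψ p ∂μΩ

instance isFiniteMeasure_μΩ : IsFiniteMeasure μΩ :=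
  ⟨by
    have h : Ω ⊆ Icc (0 : ℝ) 1 ×ˢ Icc (0 : ℝ) 1 :=
      Set.prod_mono Ioo_subset_Icc_self Ioo_subset_Icc_self
    rw [Measure.restrict_apply_univ]
    exact lt_of_le_of_lt (measure_mono h) (isCompact_Icc.prod isCompact_Icc).measure_lt_top⟩

theorem integrable_mul_of_continuous (v : L2Ω) {ψ : ℝ × ℝ → ℝ} (hψ : Continuous ψ)
    (hc : HasCompactSupport ψ) : Integrable (fun p => v p * ψ p) μΩ := by
  obtain ⟨C, hC⟩ := hψ.bounded_above_of_compact_support hc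
  exact ((Lp.memLp v).integrable (by norm_num)).mul_bdd (c := C)
    hψ.aestronglyMeasurable (Eventually.of_forall hC)

theorem continuous_partialDeriv (i : Fin 2) {ψ : ℝ × ℝ → ℝ} (hψ : ContDiff ℝ ∞ ψ) :
    Continuous (partialDeriv i ψ) :=
  (hψ.continuous_fderiv (by simp)).clm_apply continuous_const

theorem hasCompactSupport_partialDeriv (i : Fin 2) {ψ : ℝ × ℝ → ℝ}
    (hc : HasCompactSupport ψ) : HasCompactSupport (partialDeriv i ψ) :=
  hc.fderiv_apply ℝ (dir i)

theorem HasWeakPartial.zero (i : Fin 2) : HasWeakPartial i 0 0 := by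
  intro ψ _ _ _
  have h0 := Lp.coeFn_zero ℝ 2 μΩ
  have e1 : ∫ p, (0 : L2Ω) p * partialDeriv i ψ p ∂μΩ = 0 := by
    rw [integral_eq_zero_of_ae]
    filter_upwards [h0] with p hp
    rw [hp]; simp
  have e2 : ∫ p, (0 : L2Ω) p * ψ p ∂μΩ = 0 := by
    rw [integral_eq_zero_of_ae]
    filter_upwards [h0] with p hp
    rw [hp]; simp
  rw [e1, e2, neg_zero]

theorem integral_add_mul (v w : L2Ω) {ψ : ℝ × ℝ → ℝ} (hψ : Continuous ψ)
    (hc : HasCompactSupport ψ) :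
    ∫ p, (v + w) p * ψ p ∂μΩ = ∫ p, v p * ψ p ∂μΩ + ∫ p, w p * ψ p ∂μΩ := by
  rw [← integral_add (integrable_mul_of_continuous v hψ hc)
    (integrable_mul_of_continuous w hψ hc)]
  refine integral_congr_ae ?_
  filter_upwards [Lp.coeFn_add v w] with p hp
  rw [hp, Pi.add_apply, add_mul]

theorem integral_smul_mul (c : ℝ) (v : L2Ω) (ψ : ℝ × ℝ → ℝ) :
    ∫ p, (c • v) p * ψ p ∂μΩ = c * ∫ p, v p * ψ p ∂μΩ := by
  rw [← integral_const_mul]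
  refine integral_congr_ae ?_
  filter_upwards [Lp.coeFn_smul c v] with p hp
  rw [hp, Pi.smul_apply, smul_eq_mul, mul_assoc]

theorem HasWeakPartial.add {i : Fin 2} {v v' w w' : L2Ω} (h : HasWeakPartial i v w)
    (h' : HasWeakPartial i v' w') : HasWeakPartial i (v + v') (w + w') := by
  intro ψ h1 h2 h3
  rw [integral_add_mul v v' (continuous_partialDeriv i h1) (hasCompactSupport_partialDeriv i h2),
    integral_add_mul w w' h1.continuous h2, h ψ h1 h2 h3, h' ψ h1 h2 h3, neg_add]

theorem HasWeakPartial.smul {i : Fin 2} (c : ℝ) {v w : L2Ω} (h : HasWeakPartial i v w) :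
    HasWeakPartial i (c • v) (c • w) := by
  intro ψ h1 h2 h3
  rw [integral_smul_mul, integral_smul_mul, h ψ h1 h2 h3, mul_neg]

/-- The Sobolev space `H¹(Ω)`. A function `v` is stored together with its weak partial derivatives
(which it determines): component `none` is `v`, component `some i` is `∂ᵢv`. The norm
inherited from the `ℓ²`-product is `‖v‖² = ‖v‖²_{L²} + ∑ᵢ ‖∂ᵢv‖²_{L²}`. -/
def H1 : Submodule ℝ (PiLp 2 (fun _ : Option (Fin 2) => L2Ω)) where
  carrier := {J | ∀ i, HasWeakPartial i (J none) (J (some i))}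
  add_mem' := fun ha hb i => (ha i).add (hb i)
  zero_mem' := fun i => HasWeakPartial.zero i
  smul_mem' := fun c _ ha i => (ha i).smul c

/-- The Sobolev space `H²(Ω)`. A function `v` is stored together with its weak partial
derivatives: component `inl ()` is `v`, component `inr (inl i)` is `∂ᵢv`, component
`inr (inr (i, j))` is `∂ⱼ∂ᵢv`. The norm inherited from the `ℓ²`-product is
`‖v‖² = ‖v‖²_{L²} + ∑ᵢ ‖∂ᵢv‖²_{L²} + ∑ᵢⱼ ‖∂ⱼ∂ᵢv‖²_{L²}`. -/
def H2 : Submodule ℝ (PiLp 2 (fun _ : Unit ⊕ Fin 2 ⊕ (Fin 2 × Fin 2) => L2Ω)) where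
  carrier := {J | ∀ i, HasWeakPartial i (J (.inl ())) (J (.inr (.inl i))) ∧
    ∀ j, HasWeakPartial j (J (.inr (.inl i))) (J (.inr (.inr (i, j))))}
  add_mem' := fun ha hb i => ⟨(ha i).1.add (hb i).1, fun j => ((ha i).2 j).add ((hb i).2 j)⟩
  zero_mem' := fun i => ⟨HasWeakPartial.zero i, fun j => HasWeakPartial.zero j⟩
  smul_mem' := fun c _ ha i => ⟨(ha i).1.smul c, fun j => ((ha i).2 j).smul c⟩

/-- The underlying `L²`-function of `v ∈ H¹(Ω)`. -/
def h1Val (v : H1) : L2Ω := v.1 none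

/-- The weak derivative `∂ᵢv ∈ L²(Ω)` of `v ∈ H¹(Ω)`. -/
def h1Partial (v : H1) (i : Fin 2) : L2Ω := v.1 (some i)

/-- The underlying `L²`-function of `v ∈ H²(Ω)`. -/
def h2Val (v : H2) : L2Ω := v.1 (.inl ())

/-- The inclusion `H²(Ω) ⊆ H¹(Ω)`. -/
def h2ToH1 (v : H2) : H1 :=
  ⟨WithLp.toLp 2 fun o => o.elim (v.1 (.inl ())) (fun i => v.1 (.inr (.inl i))),
    fun i => (v.2 i).1⟩

/-- The weak derivative `∂ᵢv ∈ H¹(Ω)` of `v ∈ H²(Ω)`. -/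
def h2Partial (v : H2) (i : Fin 2) : H1 :=
  ⟨WithLp.toLp 2 fun o => o.elim (v.1 (.inr (.inl i))) (fun j => v.1 (.inr (.inr (i, j)))),
    fun j => (v.2 i).2 j⟩

/-- The Laplacian `Δv = v_xx + v_yy ∈ L²(Ω)` of `v ∈ H²(Ω)`. -/
def laplacian (v : H2) : L2Ω := h1Partial (h2Partial v 0) 0 + h1Partial (h2Partial v 1) 1

/-- The four sides of the square. -/
inductive Side where
  | left
  | right
  | bottom
  | top

/-- The parametrization of a side by `(0,1)`: `left` is `x = 0`, `right` is `x = 1`,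
`bottom` is `y = 0`, `top` is `y = 1`. -/
def Side.param : Side → ℝ → ℝ × ℝ
  | .left, s => (0, s)
  | .right, s => (1, s)
  | .bottom, s => (s, 0)
  | .top, s => (s, 1)

/-- `w ∈ L²(0,1)` is the trace of `v ∈ H¹(Ω)` on the side `S`. The trace operator
`H¹(Ω) → L²(S)` is the continuous extension of the restriction `ψ ↦ ψ|_S` of functions `ψ` smooth
up to the boundary (which are dense in `H¹(Ω)`); so `w` is the trace of `v` iff there are such
functions `ψₖ` with `ψₖ → v` in `H¹(Ω)` and `ψₖ|_S → w` in `L²(S)`. -/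
def HasTrace (v : H1) (S : Side) (w : Lp ℝ 2 μI) : Prop :=
  ∃ ψ : ℕ → ℝ × ℝ → ℝ, (∀ k, ContDiff ℝ ∞ (ψ k)) ∧
    Tendsto (fun k => eLpNorm (fun p => ψ k p - h1Val v p) 2 μΩ) atTop (𝓝 0) ∧
    (∀ i, Tendsto (fun k => eLpNorm (fun p => partialDeriv i (ψ k) p - h1Partial v i p) 2 μΩ)
      atTop (𝓝 0)) ∧
    Tendsto (fun k => eLpNorm (fun s => ψ k (S.param s) - w s) 2 μI) atTop (𝓝 0)

/-- `u ∈ C¹([0,1]; L²(Ω))` (one-sided derivatives at the end points). -/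
def MemC1 (u : ℝ → L2Ω) : Prop := ContDiffOn ℝ 1 u (Icc 0 1)

/-- `u ∈ L²(0,1; H²(Ω))`: for a.e. `t` the function `u(t)` is in `H²(Ω)`, and as an `H²(Ω)`-valued
function `u` is strongly measurable and square integrable on `(0,1)`. -/
def MemL2H2 (u : ℝ → L2Ω) : Prop :=
  ∃ U : ℝ → H2, MemLp U 2 μI ∧ ∀ᵐ t ∂μI, h2Val (U t) = u t

/-- The pair `(u, f)` satisfies the system
`u_t - Δu = φ(t) f(x,y)` in `Ω × (0,1)`,
`u_x(0,y,t) = u_x(1,y,t) = u_y(x,0,t) = u_y(x,1,t) = 0`, `u(1,y,t) = 0`,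
`u(x,y,0) = g₀(x,y)`, `u(x,y,1) = g₁(x,y)`:
the equation holds in `L²(Ω)` and the boundary conditions hold in the sense of traces, for
a.e. `t ∈ (0,1)`; the initial and final conditions hold in `L²(Ω)`. -/
structure SolvesSystem (φ : Lp ℝ 1 μI) (g₀ g₁ : L2Ω) (u : ℝ → L2Ω) (f : L2Ω) : Prop where
  ae_time : ∀ᵐ t ∂μI, ∃ v : H2, h2Val v = u t ∧
    derivWithin u (Icc 0 1) t - laplacian v = φ t • f ∧
    HasTrace (h2Partial v 0) .left 0 ∧
    HasTrace (h2Partial v 0) .right 0 ∧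
    HasTrace (h2Partial v 1) .bottom 0 ∧
    HasTrace (h2Partial v 1) .top 0 ∧
    HasTrace (h2ToH1 v) .right 0
  initial : u 0 = g₀
  final : u 1 = g₁

end HeatSource

end

noncomputable section
namespace HeatSource

/-! Test the equation against `G = cos (a x) cos (b y)` with `sin b = 0` and `a` an arbitrary real
number. Two integrations by parts leave no boundary terms: the Neumann conditions remove those with
the normal derivative of `u`, `G_y` vanishes for `y = 0` and `y = 1`, `G_x` vanishes for `x = 0`,
and `u` itself vanishes for `x = 1`. This last condition is what frees `a` from the discrete
spectrum (`integral_laplacian_mul_cosProd`).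

Hence `∫ u G` solves a scalar linear equation with rate `l = a ^ 2 + b ^ 2`. Integrating it up to `t
= 1` expresses `(∫ φ e^{ls} ds) · ∫ f G` through `g₀` and `g₁` alone
(`SolvesSystem.exp_mul_pairing`). For two solutions, the difference `c(a)` of the source
coefficients therefore satisfies `(∫ φ e^{ls} ds) · c(a) = 0` for every real `a`. If `c` is nonzero
at some `a`, then by continuity it is nonzero nearby, so the Laplace transform of `φ` vanishes on an
interval. That transform is entire, so `φ = 0` (`ae_eq_zero_of_integral_mul_exp_eq_zero`), a
contradiction.

The cosine products with frequencies in `πℤ` are complete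
(`eq_zero_of_integral_mul_cosProd_eq_zero`), so the sources agree. The same formula at time `t` then
gives equality of the temperatures. -/

theorem integrable_mul_of_memLp_two {α : Type*} [MeasurableSpace α] {μ : Measure α}
    {f g : α → ℝ} (hf : MemLp f 2 μ) (hg : MemLp g 2 μ) : Integrable (fun p => f p * g p) μ :=
  hf.integrable_mul hg

theorem tendsto_integral_mul_of_tendsto_eLpNorm_two {α : Type*} [MeasurableSpace α]
    {μ : Measure α} {f : ℕ → α → ℝ} {g h : α → ℝ} (hf : ∀ k, MemLp (f k) 2 μ)
    (hg : MemLp g 2 μ) (hh : MemLp h 2 μ)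
    (hlim : Tendsto (fun k => eLpNorm (fun p => f k p - g p) 2 μ) atTop (𝓝 0)) :
    Tendsto (fun k => ∫ p, f k p * h p ∂μ) atTop (𝓝 (∫ p, g p * h p ∂μ)) := by
  refine tendsto_integral_of_L1' _ (hg.integrable_mul hh).aestronglyMeasurable
    (Eventually.of_forall fun k => (hf k).integrable_mul hh) ?_
  have hb : ∀ k, eLpNorm ((fun p => f k p * h p) - fun p => g p * h p) 1 μ
      ≤ eLpNorm (fun p => f k p - g p) 2 μ * eLpNorm h 2 μ := by
    intro k
    have := eLpNorm_smul_le_mul_eLpNorm (p := 2) (q := 2) (r := 1) (μ := μ)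
      hh.aestronglyMeasurable ((hf k).sub hg).aestronglyMeasurable
    have he : ((fun p => f k p * h p) - fun p => g p * h p) = (f k - g) • h := by
      ext p
      simp [sub_mul]
    rw [he]
    exact this
  have hz : Tendsto (fun k => eLpNorm (fun p => f k p - g p) 2 μ * eLpNorm h 2 μ) atTop (𝓝 0) := by
    simpa using ENNReal.Tendsto.mul_const hlim (Or.inr hh.eLpNorm_ne_top)
  exact tendsto_of_tendsto_of_tendsto_of_le_of_le tendsto_const_nhds hz (fun _ => zero_le) hb

theorem memLp_μΩ_of_continuous {g : ℝ × ℝ → ℝ} (hg : Continuous g) (q : ℝ≥0∞) :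
    MemLp g q μΩ := by
  obtain ⟨C, hC⟩ := (isCompact_Icc.prod isCompact_Icc : IsCompact
    (Icc (0 : ℝ) 1 ×ˢ Icc (0 : ℝ) 1)).exists_bound_of_continuousOn hg.continuousOn
  refine MemLp.of_bound hg.aestronglyMeasurable C ?_
  filter_upwards [ae_restrict_mem (measurableSet_Ioo.prod measurableSet_Ioo)] with p hp
  exact hC p (Set.prod_mono Ioo_subset_Icc_self Ioo_subset_Icc_self hp)

theorem memLp_μI_of_continuous {g : ℝ → ℝ} (hg : Continuous g) (q : ℝ≥0∞) :
    MemLp g q μI := by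
  obtain ⟨C, hC⟩ := (isCompact_Icc : IsCompact
    (Icc (0 : ℝ) 1)).exists_bound_of_continuousOn hg.continuousOn
  refine MemLp.of_bound hg.aestronglyMeasurable C ?_
  filter_upwards [ae_restrict_mem measurableSet_Ioo] with p hp
  exact hC p (Ioo_subset_Icc_self hp)

theorem μΩ_eq_prod : μΩ = μI.prod μI := by
  rw [Measure.prod_restrict, ← Measure.volume_eq_prod]; rfl

theorem integral_μI_eq_intervalIntegral (g : ℝ → ℝ) : ∫ s, g s ∂μI = ∫ s in (0 : ℝ)..1, g s := by
  rw [intervalIntegral.integral_of_le zero_le_one, integral_Ioc_eq_integral_Ioo]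

/-! ### Integration by parts with vanishing traces -/

/-- The side on which the `i`-th coordinate is `1`. -/
def highSide (i : Fin 2) : Side := if i = 0 then .right else .top

/-- The side on which the `i`-th coordinate is `0`. -/
def lowSide (i : Fin 2) : Side := if i = 0 then .left else .bottom

theorem highSide_zero : highSide 0 = .right := if_pos rfl

theorem highSide_one : highSide 1 = .top := if_neg one_ne_zero

theorem lowSide_zero : lowSide 0 = .left := if_pos rfl

theorem lowSide_one : lowSide 1 = .bottom := if_neg one_ne_zero

theorem continuous_param (S : Side) : Continuous S.param := by
  cases S <;> (change Continuous fun s : ℝ => ((_ : ℝ), (_ : ℝ))) <;> fun_prop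

theorem integral_partialDeriv (i : Fin 2) {H : ℝ × ℝ → ℝ} (hH : ContDiff ℝ ∞ H) :
    ∫ p, partialDeriv i H p ∂μΩ =
      ∫ s, H ((highSide i).param s) - H ((lowSide i).param s) ∂μI := by
  have hi : Integrable (partialDeriv i H) (μI.prod μI) := by
    rw [← μΩ_eq_prod]
    exact (memLp_μΩ_of_continuous (continuous_partialDeriv i hH) 1).integrable le_rfl
  have hd : Differentiable ℝ H := hH.differentiable (by simp)
  rw [μΩ_eq_prod]
  fin_cases i
  · refine (integral_prod_symm _ hi).trans (integral_congr_ae (Eventually.of_forall fun y => ?_))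
    change ∫ x, partialDeriv 0 H (x, y) ∂μI = H (1, y) - H (0, y)
    rw [integral_μI_eq_intervalIntegral]
    refine intervalIntegral.integral_eq_sub_of_hasDerivAt (f := fun x => H (x, y)) (fun x _ => ?_)
      (((continuous_partialDeriv 0 hH).comp (by fun_prop)).intervalIntegrable _ _)
    exact (hd (x, y)).hasFDerivAt.comp_hasDerivAt x ((hasDerivAt_id x).prodMk (hasDerivAt_const x y))
  · refine (integral_prod _ hi).trans (integral_congr_ae (Eventually.of_forall fun x => ?_))
    change ∫ y, partialDeriv 1 H (x, y) ∂μI = H (x, 1) - H (x, 0)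
    rw [integral_μI_eq_intervalIntegral]
    refine intervalIntegral.integral_eq_sub_of_hasDerivAt (f := fun y => H (x, y)) (fun y _ => ?_)
      (((continuous_partialDeriv 1 hH).comp (by fun_prop)).intervalIntegrable _ _)
    exact (hd (x, y)).hasFDerivAt.comp_hasDerivAt y ((hasDerivAt_const y x).prodMk (hasDerivAt_id y))

theorem partialDeriv_mul (i : Fin 2) {ψ G : ℝ × ℝ → ℝ} (hψ : ContDiff ℝ ∞ ψ)
    (hG : ContDiff ℝ ∞ G) (p : ℝ × ℝ) :
    partialDeriv i (fun p => ψ p * G p) p = partialDeriv i ψ p * G p + ψ p * partialDeriv i G p := by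
  have h1 := (hψ.differentiable (by simp)) p
  have h2 := (hG.differentiable (by simp)) p
  simp only [partialDeriv]
  rw [fderiv_fun_mul h1 h2]
  simp only [add_apply, smul_apply, smul_eq_mul]
  ring

/-- The formula `∫ ∂ᵢv G + ∫ v ∂ᵢG = 0` of integration by parts without boundary terms. -/
def IntByParts (v : H1) (i : Fin 2) (G : ℝ × ℝ → ℝ) : Prop :=
  ∫ p, h1Partial v i p * G p ∂μΩ = - ∫ p, h1Val v p * partialDeriv i G p ∂μΩ

/-- For smooth `ψ k` the formula is exact up to a boundary integral, and both area integrals pass to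
the `L²` limit. Only the boundary integral has to be controlled. -/
theorem intByParts_of_tendsto {v : H1} {i : Fin 2} {G : ℝ × ℝ → ℝ} (hG : ContDiff ℝ ∞ G)
    {ψ : ℕ → ℝ × ℝ → ℝ} (hψ : ∀ k, ContDiff ℝ ∞ (ψ k))
    (h0 : Tendsto (fun k => eLpNorm (fun p => ψ k p - h1Val v p) 2 μΩ) atTop (𝓝 0))
    (h1 : Tendsto (fun k => eLpNorm (fun p => partialDeriv i (ψ k) p - h1Partial v i p) 2 μΩ)
      atTop (𝓝 0))
    (hb : Tendsto (fun k => ∫ s, ψ k ((highSide i).param s) * G ((highSide i).param s)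
      - ψ k ((lowSide i).param s) * G ((lowSide i).param s) ∂μI) atTop (𝓝 0)) :
    IntByParts v i G := by
  have hGc := memLp_μΩ_of_continuous hG.continuous 2
  have hGd := memLp_μΩ_of_continuous (continuous_partialDeriv i hG) 2
  have hψc := fun k => memLp_μΩ_of_continuous (hψ k).continuous 2
  have hψd := fun k => memLp_μΩ_of_continuous (continuous_partialDeriv i (hψ k)) 2
  have t0 := tendsto_integral_mul_of_tendsto_eLpNorm_two hψc (Lp.memLp (h1Val v)) hGd h0
  have t1 := tendsto_integral_mul_of_tendsto_eLpNorm_two hψd (Lp.memLp (h1Partial v i)) hGc h1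
  have key : ∀ k, ∫ s, ψ k ((highSide i).param s) * G ((highSide i).param s)
      - ψ k ((lowSide i).param s) * G ((lowSide i).param s) ∂μI =
      ∫ p, partialDeriv i (ψ k) p * G p ∂μΩ + ∫ p, ψ k p * partialDeriv i G p ∂μΩ := by
    intro k
    rw [← integral_partialDeriv i ((hψ k).mul hG), ← integral_add (integrable_mul_of_memLp_two (hψd k) hGc)
      (integrable_mul_of_memLp_two (hψc k) hGd)]
    exact integral_congr_ae (Eventually.of_forall fun p => partialDeriv_mul i (hψ k) hG p)
  simp only [key] at hb
  exact eq_neg_of_add_eq_zero_left (tendsto_nhds_unique (t1.add t0) hb)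

theorem tendsto_integral_side {S : Side} {G : ℝ × ℝ → ℝ} (hG : Continuous G)
    {ψ : ℕ → ℝ × ℝ → ℝ} (hψ : ∀ k, ContDiff ℝ ∞ (ψ k))
    (h : Tendsto (fun k => eLpNorm (fun s => ψ k (S.param s) - (0 : Lp ℝ 2 μI) s) 2 μI)
      atTop (𝓝 0)) :
    Tendsto (fun k => ∫ s, ψ k (S.param s) * G (S.param s) ∂μI) atTop (𝓝 0) := by
  have := tendsto_integral_mul_of_tendsto_eLpNorm_two
    (fun k => memLp_μI_of_continuous ((hψ k).continuous.comp (continuous_param S)) 2)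
    (Lp.memLp (0 : Lp ℝ 2 μI)) (memLp_μI_of_continuous (hG.comp (continuous_param S)) 2) h
  rwa [integral_eq_zero_of_ae] at this
  filter_upwards [Lp.coeFn_zero ℝ 2 μI] with s hs
  rw [hs, Pi.zero_apply, zero_mul]

/-- The approximants are controlled on one side only, so `G` must remove the contribution of the
opposite side. -/
theorem HasTrace.intByParts_high {v : H1} {i : Fin 2} (h : HasTrace v (highSide i) 0)
    {G : ℝ × ℝ → ℝ} (hG : ContDiff ℝ ∞ G) (hlow : ∀ s, G ((lowSide i).param s) = 0) :
    IntByParts v i G := by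
  obtain ⟨ψ, hψ, h0, h1, hS⟩ := h
  refine intByParts_of_tendsto hG hψ h0 (h1 i) ?_
  simpa [hlow] using tendsto_integral_side hG.continuous hψ hS

theorem HasTrace.intByParts_low {v : H1} {i : Fin 2} (h : HasTrace v (lowSide i) 0)
    {G : ℝ × ℝ → ℝ} (hG : ContDiff ℝ ∞ G) (hhigh : ∀ s, G ((highSide i).param s) = 0) :
    IntByParts v i G := by
  obtain ⟨ψ, hψ, h0, h1, hS⟩ := h
  refine intByParts_of_tendsto hG hψ h0 (h1 i) ?_
  simpa [hhigh, integral_neg] using (tendsto_integral_side hG.continuous hψ hS).neg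

/-- When `G` vanishes on both sides, any trace will do: it only supplies smooth functions converging
to `v` in `H¹`. -/
theorem HasTrace.intByParts {v : H1} {i : Fin 2} {S : Side} {w : Lp ℝ 2 μI} (h : HasTrace v S w)
    {G : ℝ × ℝ → ℝ} (hG : ContDiff ℝ ∞ G) (hlow : ∀ s, G ((lowSide i).param s) = 0)
    (hhigh : ∀ s, G ((highSide i).param s) = 0) : IntByParts v i G := by
  obtain ⟨ψ, hψ, h0, h1, -⟩ := h
  exact intByParts_of_tendsto hG hψ h0 (h1 i) (by simp [hlow, hhigh])

theorem IntByParts.add {v : H1} {i : Fin 2} {G G' : ℝ × ℝ → ℝ} (hG : ContDiff ℝ ∞ G)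
    (hG' : ContDiff ℝ ∞ G') (h : IntByParts v i G) (h' : IntByParts v i G') :
    IntByParts v i (fun p => G p + G' p) := by
  have hp : ∀ p, partialDeriv i (fun p => G p + G' p) p = partialDeriv i G p + partialDeriv i G' p := by
    intro p
    simp only [partialDeriv]
    rw [fderiv_fun_add (hG.differentiable (by simp) p) (hG'.differentiable (by simp) p)]
    rfl
  have m := fun {F : ℝ × ℝ → ℝ} (hF : Continuous F) => memLp_μΩ_of_continuous hF 2
  unfold IntByParts at *
  simp only [hp, mul_add]
  rw [integral_add (integrable_mul_of_memLp_two (Lp.memLp (h1Partial v i)) (m hG.continuous))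
      (integrable_mul_of_memLp_two (Lp.memLp (h1Partial v i)) (m hG'.continuous)),
    integral_add (integrable_mul_of_memLp_two (Lp.memLp (h1Val v)) (m (continuous_partialDeriv i hG)))
      (integrable_mul_of_memLp_two (Lp.memLp (h1Val v)) (m (continuous_partialDeriv i hG'))), h, h', neg_add]

/-- The two traces may come from different approximating sequences, so they are used separately.
With `c` the `i`-th coordinate, `G = c G + (1 - c) G` splits into a part vanishing on the low side
and a part vanishing on the high side. -/
theorem HasTrace.intByParts_both {v : H1} {i : Fin 2} (hl : HasTrace v (lowSide i) 0)
    (hh : HasTrace v (highSide i) 0) {G : ℝ × ℝ → ℝ} (hG : ContDiff ℝ ∞ G) :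
    IntByParts v i G := by
  obtain ⟨c, hc, hc0, hc1⟩ : ∃ c : ℝ × ℝ → ℝ, ContDiff ℝ ∞ c ∧
      (∀ s, c ((lowSide i).param s) = 0) ∧ ∀ s, c ((highSide i).param s) = 1 := by
    fin_cases i
    · exact ⟨Prod.fst, contDiff_fst, fun _ => rfl, fun _ => rfl⟩
    · exact ⟨Prod.snd, contDiff_snd, fun _ => rfl, fun _ => rfl⟩
  have hG1 : ContDiff ℝ ∞ fun p => c p * G p := hc.mul hG
  have hG2 : ContDiff ℝ ∞ fun p => (1 - c p) * G p := (contDiff_const.sub hc).mul hG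
  have := (hh.intByParts_high hG1 (by simp [hc0])).add hG1 hG2
    (hl.intByParts_low hG2 (by simp [hc1]))
  simpa [← add_mul] using this

/-! ### Green's formula for products of cosines -/

/-- The function `cos (a x) cos (b y)`. -/
def cosProd (a b : ℝ) (p : ℝ × ℝ) : ℝ := Real.cos (a * p.1) * Real.cos (b * p.2)

theorem contDiff_cosProd (a b : ℝ) : ContDiff ℝ ∞ (cosProd a b) := by
  unfold cosProd; fun_prop

theorem hasDerivAt_cos_mul (a x : ℝ) :
    HasDerivAt (fun x => Real.cos (a * x)) (-(a * Real.sin (a * x))) x := by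
  have := (hasDerivAt_const_mul (x := x) a).cos
  rwa [neg_mul, mul_comm] at this

theorem hasDerivAt_neg_mul_sin_mul (a x : ℝ) :
    HasDerivAt (fun x => -(a * Real.sin (a * x))) (-(a ^ 2 * Real.cos (a * x))) x := by
  exact ((hasDerivAt_const_mul (x := x) a).sin.const_mul a).fun_neg.congr_deriv (by ring)

theorem partialDeriv_zero_mul {A B : ℝ → ℝ} {d : ℝ} {p : ℝ × ℝ} (hB : DifferentiableAt ℝ B p.2)
    (h : HasDerivAt A d p.1) : partialDeriv 0 (fun q => A q.1 * B q.2) p = d * B p.2 := by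
  have h1 := h.comp_hasFDerivAt p (hasFDerivAt_fst (𝕜 := ℝ) (p := p))
  have h2 := hB.hasDerivAt.comp_hasFDerivAt p (hasFDerivAt_snd (𝕜 := ℝ) (p := p))
  have := (h1.mul h2).fderiv
  simp only [partialDeriv]
  erw [this]
  simp [dir, mul_comm]

theorem partialDeriv_one_mul {A B : ℝ → ℝ} {d : ℝ} {p : ℝ × ℝ} (hA : DifferentiableAt ℝ A p.1)
    (h : HasDerivAt B d p.2) : partialDeriv 1 (fun q => A q.1 * B q.2) p = A p.1 * d := by
  have h1 := hA.hasDerivAt.comp_hasFDerivAt p (hasFDerivAt_fst (𝕜 := ℝ) (p := p))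
  have h2 := h.comp_hasFDerivAt p (hasFDerivAt_snd (𝕜 := ℝ) (p := p))
  have := (h1.mul h2).fderiv
  simp only [partialDeriv]
  erw [this]
  simp [dir]

theorem partialDeriv_zero_cosProd (a b : ℝ) : partialDeriv 0 (cosProd a b) =
    fun q => -(a * Real.sin (a * q.1)) * Real.cos (b * q.2) :=
  funext fun p => partialDeriv_zero_mul (B := fun y => Real.cos (b * y))
    (hasDerivAt_cos_mul b p.2).differentiableAt (hasDerivAt_cos_mul a p.1)

theorem partialDeriv_one_cosProd (a b : ℝ) : partialDeriv 1 (cosProd a b) =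
    fun q => Real.cos (a * q.1) * -(b * Real.sin (b * q.2)) :=
  funext fun p => partialDeriv_one_mul (A := fun y => Real.cos (a * y))
    (hasDerivAt_cos_mul a p.1).differentiableAt (hasDerivAt_cos_mul b p.2)

theorem partialDeriv_zero_zero_cosProd (a b : ℝ) : partialDeriv 0 (partialDeriv 0 (cosProd a b)) =
    fun q => -(a ^ 2) * cosProd a b q := by
  rw [partialDeriv_zero_cosProd]
  funext p
  rw [partialDeriv_zero_mul (A := fun x => -(a * Real.sin (a * x))) (B := fun y => Real.cos (b * y))
    (hasDerivAt_cos_mul b p.2).differentiableAt (hasDerivAt_neg_mul_sin_mul a p.1), cosProd]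
  ring

theorem partialDeriv_one_one_cosProd (a b : ℝ) : partialDeriv 1 (partialDeriv 1 (cosProd a b)) =
    fun q => -(b ^ 2) * cosProd a b q := by
  rw [partialDeriv_one_cosProd]
  funext p
  rw [partialDeriv_one_mul (A := fun x => Real.cos (a * x)) (B := fun y => -(b * Real.sin (b * y)))
    (hasDerivAt_cos_mul a p.1).differentiableAt (hasDerivAt_neg_mul_sin_mul b p.2), cosProd]
  ring

theorem integral_laplacian_mul (v : H2) {G : ℝ × ℝ → ℝ} (hG : Continuous G) :
    ∫ p, laplacian v p * G p ∂μΩ = ∫ p, h1Partial (h2Partial v 0) 0 p * G p ∂μΩ +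
      ∫ p, h1Partial (h2Partial v 1) 1 p * G p ∂μΩ := by
  have m := memLp_μΩ_of_continuous hG 2
  unfold laplacian
  generalize h1Partial (h2Partial v 0) 0 = f
  generalize h1Partial (h2Partial v 1) 1 = g
  rw [← integral_add (integrable_mul_of_memLp_two (Lp.memLp f) m)
    (integrable_mul_of_memLp_two (Lp.memLp g) m)]
  refine integral_congr_ae ?_
  filter_upwards [Lp.coeFn_add f g] with p hp
  rw [hp, Pi.add_apply, add_mul]

/-- Green's formula against `cos (a x) cos (b y)`. -/
theorem integral_laplacian_mul_cosProd {v : H2} (hl : HasTrace (h2Partial v 0) .left 0)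
    (hr : HasTrace (h2Partial v 0) .right 0) (hb : HasTrace (h2Partial v 1) .bottom 0)
    (ht : HasTrace (h2Partial v 1) .top 0) (hv : HasTrace (h2ToH1 v) .right 0) (a : ℝ) {b : ℝ}
    (hsin : Real.sin b = 0) :
    ∫ p, laplacian v p * cosProd a b p ∂μΩ = -(a ^ 2 + b ^ 2) * ∫ p, h2Val v p * cosProd a b p ∂μΩ := by
  have hW := contDiff_cosProd a b
  have d0 : ContDiff ℝ ∞ (partialDeriv 0 (cosProd a b)) := by
    rw [partialDeriv_zero_cosProd]; fun_prop
  have d1 : ContDiff ℝ ∞ (partialDeriv 1 (cosProd a b)) := by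
    rw [partialDeriv_one_cosProd]; fun_prop
  have x1 : IntByParts (h2Partial v 0) 0 (cosProd a b) :=
    HasTrace.intByParts_both (by rwa [lowSide_zero]) (by rwa [highSide_zero]) hW
  have y1 : IntByParts (h2Partial v 1) 1 (cosProd a b) :=
    HasTrace.intByParts_both (by rwa [lowSide_one]) (by rwa [highSide_one]) hW
  -- At `x = 0` the factor `sin (a x)` vanishes; at `x = 1` the Dirichlet trace does the work, so
  -- `sin a` may be nonzero.
  have x2 : IntByParts (h2ToH1 v) 0 (partialDeriv 0 (cosProd a b)) :=
    HasTrace.intByParts_high (by rwa [highSide_zero]) d0 fun s => by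
      simp [partialDeriv_zero_cosProd, lowSide_zero, Side.param]
  have y2 : IntByParts (h2ToH1 v) 1 (partialDeriv 1 (cosProd a b)) :=
    HasTrace.intByParts hv d1
      (fun s => by simp [partialDeriv_one_cosProd, lowSide_one, Side.param])
      (fun s => by simp [partialDeriv_one_cosProd, highSide_one, Side.param, hsin])
  unfold IntByParts at x1 x2 y1 y2
  rw [partialDeriv_zero_zero_cosProd] at x2
  rw [partialDeriv_one_one_cosProd] at y2
  have e : ∀ c : ℝ, ∫ p, h1Val (h2ToH1 v) p * (c * cosProd a b p) ∂μΩ =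
      c * ∫ p, h2Val v p * cosProd a b p ∂μΩ := by
    intro c
    rw [← integral_const_mul]
    refine integral_congr_ae (Eventually.of_forall fun p => ?_)
    change h2Val v p * (c * cosProd a b p) = _
    ring
  rw [e] at x2 y2
  have x3 : h1Val (h2Partial v 0) = h1Partial (h2ToH1 v) 0 := rfl
  have y3 : h1Val (h2Partial v 1) = h1Partial (h2ToH1 v) 1 := rfl
  rw [integral_laplacian_mul v hW.continuous, x1, y1, x3, y3, x2, y2]
  ring

/-! ### Injectivity of the Laplace transform on the unit interval -/

theorem norm_exp_mul_le (s : ℝ) {t : ℝ} (ht : t ∈ Ioo (0 : ℝ) 1) :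
    ‖Real.exp (s * t)‖ ≤ Real.exp |s| := by
  rw [Real.norm_eq_abs, Real.abs_exp, Real.exp_le_exp]
  calc s * t ≤ |s| * t := mul_le_mul_of_nonneg_right (le_abs_self s) ht.1.le
    _ ≤ |s| * 1 := mul_le_mul_of_nonneg_left ht.2.le (abs_nonneg s)
    _ = |s| := mul_one _

theorem integrableExpSet_withDensity_ofReal {g : ℝ → ℝ} (hg : Integrable g μI) :
    ProbabilityTheory.integrableExpSet id (μI.withDensity fun t => ENNReal.ofReal (g t)) = univ := by
  refine eq_univ_of_forall fun s => ?_
  change Integrable (fun t => Real.exp (s * t)) _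
  have : IsFiniteMeasure (μI.withDensity fun t => ENNReal.ofReal (g t)) :=
    isFiniteMeasure_withDensity_ofReal hg.2
  refine Integrable.of_bound (by fun_prop) (Real.exp |s|) ?_
  refine (withDensity_absolutelyContinuous μI _).ae_le ?_
  filter_upwards [ae_restrict_mem measurableSet_Ioo] with t ht
  exact norm_exp_mul_le s ht

theorem mgf_withDensity_ofReal {g : ℝ → ℝ} (hg : Integrable g μI) (s : ℝ) :
    ProbabilityTheory.mgf id (μI.withDensity fun t => ENNReal.ofReal (g t)) s =
      ∫ t, max (g t) 0 * Real.exp (s * t) ∂μI := by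
  rw [ProbabilityTheory.mgf, integral_withDensity_eq_integral_toReal_smul₀
    hg.aestronglyMeasurable.aemeasurable.ennreal_ofReal (Eventually.of_forall fun _ => by simp)]
  refine integral_congr_ae (Eventually.of_forall fun t => ?_)
  simp [ENNReal.toReal_ofReal']

theorem integrable_mul_exp {g : ℝ → ℝ} (hg : Integrable g μI) (s : ℝ) :
    Integrable (fun t => g t * Real.exp (s * t)) μI := by
  refine hg.mul_bdd (c := Real.exp |s|) (by fun_prop) ?_
  filter_upwards [ae_restrict_mem measurableSet_Ioo] with t ht
  exact norm_exp_mul_le s ht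

/-- An integrable function whose Laplace transform vanishes to the right of some point is zero. -/
theorem ae_eq_zero_of_integral_mul_exp_eq_zero {g : ℝ → ℝ} (hg : Integrable g μI) {s₀ : ℝ}
    (h : ∀ᶠ s in 𝓝[>] s₀, ∫ t, g t * Real.exp (s * t) ∂μI = 0) : g =ᵐ[μI] 0 := by
  have hng : Integrable (fun t => -g t) μI := hg.neg
  -- The positive and negative parts of `g` become densities of finite measures, whose moment
  -- generating functions are entire because the interval is bounded.
  set P := μI.withDensity fun t => ENNReal.ofReal (g t) with hP
  set N := μI.withDensity fun t => ENNReal.ofReal (-g t) with hN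
  have fP : IsFiniteMeasure P := isFiniteMeasure_withDensity_ofReal hg.2
  have fN : IsFiniteMeasure N := isFiniteMeasure_withDensity_ofReal hng.2
  have aP : AnalyticOnNhd ℂ (ProbabilityTheory.complexMGF id P) univ := by
    have := ProbabilityTheory.analyticOnNhd_complexMGF (X := id) (μ := P)
    rw [hP, integrableExpSet_withDensity_ofReal hg, interior_univ] at this
    exact this
  have aN : AnalyticOnNhd ℂ (ProbabilityTheory.complexMGF id N) univ := by
    have := ProbabilityTheory.analyticOnNhd_complexMGF (X := id) (μ := N)
    rw [hN, integrableExpSet_withDensity_ofReal hng, interior_univ] at this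
    exact this
  have hmgf : ∀ᶠ s : ℝ in 𝓝[>] s₀, ProbabilityTheory.complexMGF id P (s : ℂ) =
      ProbabilityTheory.complexMGF id N (s : ℂ) := by
    filter_upwards [h] with s hs
    rw [ProbabilityTheory.complexMGF_ofReal, ProbabilityTheory.complexMGF_ofReal,
      mgf_withDensity_ofReal hg, mgf_withDensity_ofReal hng, ← sub_eq_zero,
      ← Complex.ofReal_sub, ← integral_sub (integrable_mul_exp hg.pos_part s)
        (integrable_mul_exp hg.neg_part s), Complex.ofReal_eq_zero]
    refine (integral_congr_ae (Eventually.of_forall fun t => ?_)).trans hs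
    change max (g t) 0 * Real.exp (s * t) - max (-g t) 0 * Real.exp (s * t) = g t * Real.exp (s * t)
    rw [← sub_mul, max_zero_sub_max_neg_zero_eq_self]
  -- The real points to the right of `s₀` accumulate at `s₀` in `ℂ`, which is enough for the
  -- identity theorem.
  have ht : Tendsto (fun s : ℝ => (s : ℂ)) (𝓝[>] s₀) (𝓝[≠] (s₀ : ℂ)) := by
    refine tendsto_nhdsWithin_iff.2
      ⟨(Complex.continuous_ofReal.tendsto s₀).mono_left nhdsWithin_le_nhds, ?_⟩
    filter_upwards [self_mem_nhdsWithin] with s hs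
    simpa using (ne_of_gt hs : s ≠ s₀)
  have heq : ProbabilityTheory.complexMGF id P = ProbabilityTheory.complexMGF id N :=
    aP.eq_of_frequently_eq aN (ht.frequently hmgf.frequently)
  have hPN : P = N := Measure.ext_of_complexMGF_id_eq heq
  have hae := (withDensity_eq_iff hg.aestronglyMeasurable.aemeasurable.ennreal_ofReal
    hng.aestronglyMeasurable.aemeasurable.ennreal_ofReal hg.lintegral_lt_top.ne).1 hPN
  filter_upwards [hae] with t ht
  rcases lt_trichotomy (g t) 0 with h0 | h0 | h0
  · rw [ENNReal.ofReal_of_nonpos h0.le, eq_comm, ENNReal.ofReal_eq_zero] at ht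
    simp only [Pi.zero_apply]; linarith
  · exact h0
  · rw [ENNReal.ofReal_of_nonpos (neg_nonpos.2 h0.le), ENNReal.ofReal_eq_zero] at ht
    simp only [Pi.zero_apply]; linarith

/-! ### Completeness of the cosine products -/

/-- The functional `v ↦ ∫_Ω v G` on `L²(Ω)`. -/
def pairing {G : ℝ × ℝ → ℝ} (hG : Continuous G) : L2Ω →L[ℝ] ℝ :=
  innerSL ℝ ((memLp_μΩ_of_continuous hG 2).toLp G)

theorem pairing_apply {G : ℝ × ℝ → ℝ} (hG : Continuous G) (v : L2Ω) :
    pairing hG v = ∫ p, v p * G p ∂μΩ := by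
  rw [pairing, innerSL_apply_apply, L2.inner_def]
  refine integral_congr_ae ?_
  filter_upwards [(memLp_μΩ_of_continuous hG 2).coeFn_toLp] with p hp
  rw [hp]
  simp

/-- `cos (mπx) cos (nπy)` as a continuous function. -/
def cosMode (m n : ℤ) : C(ℝ × ℝ, ℝ) :=
  ⟨cosProd (m * Real.pi) (n * Real.pi), (contDiff_cosProd _ _).continuous⟩

theorem cosMode_one_zero_mul (m n : ℤ) :
    cosMode 1 0 * cosMode m n = (1 / 2 : ℝ) • (cosMode (m + 1) n + cosMode (m - 1) n) := by
  ext p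
  simp only [cosMode, cosProd, ContinuousMap.mul_apply, ContinuousMap.coe_mk,
    ContinuousMap.smul_apply, ContinuousMap.add_apply, smul_eq_mul]
  push_cast
  rw [show (m + 1 : ℝ) * Real.pi * p.1 = m * Real.pi * p.1 + Real.pi * p.1 by ring,
    show (m - 1 : ℝ) * Real.pi * p.1 = m * Real.pi * p.1 - Real.pi * p.1 by ring,
    Real.cos_add, Real.cos_sub]
  simp only [one_mul, zero_mul, Real.cos_zero]
  ring

theorem cosMode_zero_one_mul (m n : ℤ) :
    cosMode 0 1 * cosMode m n = (1 / 2 : ℝ) • (cosMode m (n + 1) + cosMode m (n - 1)) := by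
  ext p
  simp only [cosMode, cosProd, ContinuousMap.mul_apply, ContinuousMap.coe_mk,
    ContinuousMap.smul_apply, ContinuousMap.add_apply, smul_eq_mul]
  push_cast
  rw [show (n + 1 : ℝ) * Real.pi * p.2 = n * Real.pi * p.2 + Real.pi * p.2 by ring,
    show (n - 1 : ℝ) * Real.pi * p.2 = n * Real.pi * p.2 - Real.pi * p.2 by ring,
    Real.cos_add, Real.cos_sub]
  simp only [one_mul, zero_mul, Real.cos_zero]
  ring

theorem adjoin_le_span_cosMode {H : C(ℝ × ℝ, ℝ)}
    (hH : H ∈ Algebra.adjoin ℝ {cosMode 1 0, cosMode 0 1}) :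
    H ∈ Submodule.span ℝ (range fun k : ℤ × ℤ => cosMode k.1 k.2) := by
  set V := Submodule.span ℝ (range fun k : ℤ × ℤ => cosMode k.1 k.2)
  have hV : ∀ m n, cosMode m n ∈ V := fun m n => Submodule.subset_span ⟨(m, n), rfl⟩
  -- Stability of `V` under multiplication by `H` passes to products, unlike plain membership in
  -- `V`; applying it to `1 ∈ V` gives the claim.
  have key : ∀ v ∈ V, H * v ∈ V := by
    induction hH using Algebra.adjoin_induction with
    | mem x hx =>
      intro v hv
      induction hv using Submodule.span_induction with
      | mem v hv =>
        obtain ⟨⟨m, n⟩, rfl⟩ := hv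
        rcases hx with rfl | rfl
        · rw [cosMode_one_zero_mul]
          exact V.smul_mem _ (V.add_mem (hV _ _) (hV _ _))
        · rw [cosMode_zero_one_mul]
          exact V.smul_mem _ (V.add_mem (hV _ _) (hV _ _))
      | zero => rw [mul_zero]; exact V.zero_mem
      | add v w _ _ hv hw => rw [mul_add]; exact V.add_mem hv hw
      | smul c v _ hv => rw [mul_smul_comm]; exact V.smul_mem c hv
    | algebraMap r => intro v hv; rw [← Algebra.smul_def]; exact V.smul_mem r hv
    | add x y _ _ hx hy => intro v hv; rw [add_mul]; exact V.add_mem (hx v hv) (hy v hv)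
    | mul x y _ _ hx hy => intro v hv; rw [mul_assoc]; exact hx _ (hy v hv)
  have h1 : cosMode 0 0 = 1 := by ext p; simp [cosMode, cosProd]
  simpa [h1] using key _ (hV 0 0)

theorem cos_pi_mul_injOn : InjOn (fun x => Real.cos (Real.pi * x)) (Icc 0 1) := by
  intro x hx y hy hxy
  have hpi := Real.pi_pos
  refine mul_left_cancel₀ hpi.ne' (Real.injOn_cos ?_ ?_ hxy) <;>
  constructor <;> nlinarith [hx.1, hx.2, hy.1, hy.2]

/-- Stone–Weierstrass on the closed square: `cos (πx)` and `cos (πy)` separate its points, since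
`cos` is injective on `[0, π]`. -/
theorem exists_mem_adjoin_near (ψ : C(ℝ × ℝ, ℝ)) {ε : ℝ} (hε : 0 < ε) :
    ∃ H ∈ Algebra.adjoin ℝ {cosMode 1 0, cosMode 0 1},
      ∀ p ∈ Icc (0 : ℝ) 1 ×ˢ Icc (0 : ℝ) 1, |H p - ψ p| < ε := by
  set K := Icc (0 : ℝ) 1 ×ˢ Icc (0 : ℝ) 1
  have : CompactSpace K := isCompact_iff_compactSpace.1 (isCompact_Icc.prod isCompact_Icc)
  let R : C(ℝ × ℝ, ℝ) →ₐ[ℝ] C(K, ℝ) :=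
    ContinuousMap.compRightAlgHom ℝ ℝ ⟨Subtype.val, continuous_subtype_val⟩
  have hsep : ((Algebra.adjoin ℝ {cosMode 1 0, cosMode 0 1}).map R).SeparatesPoints := by
    rintro ⟨p, hp⟩ ⟨q, hq⟩ hpq
    have hmem : ∀ e ∈ ({cosMode 1 0, cosMode 0 1} : Set C(ℝ × ℝ, ℝ)),
        R e ∈ (Algebra.adjoin ℝ {cosMode 1 0, cosMode 0 1}).map R := fun e he =>
      ⟨e, Algebra.subset_adjoin he, rfl⟩
    by_cases h1 : p.1 = q.1
    · have h2 : p.2 ≠ q.2 := fun h2 => hpq (Subtype.ext (Prod.ext h1 h2))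
      refine ⟨_, ⟨_, hmem (cosMode 0 1) (by simp), rfl⟩, fun he => h2 ?_⟩
      exact cos_pi_mul_injOn hp.2 hq.2 (by simpa [R, cosMode, cosProd] using he)
    · refine ⟨_, ⟨_, hmem (cosMode 1 0) (by simp), rfl⟩, fun he => h1 ?_⟩
      exact cos_pi_mul_injOn hp.1 hq.1 (by simpa [R, cosMode, cosProd] using he)
  obtain ⟨⟨_, H, hH, rfl⟩, hn⟩ :=
    ContinuousMap.exists_mem_subalgebra_near_continuousMap_of_separatesPoints _ hsep (R ψ) ε hε
  exact ⟨H, hH, fun p hp => (ContinuousMap.norm_coe_le_norm (R H - R ψ) ⟨p, hp⟩).trans_lt hn⟩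

/-- The products `cos (mπx) cos (nπy)` are complete in `L²(Ω)`. -/
theorem eq_zero_of_integral_mul_cosProd_eq_zero {v : L2Ω}
    (h : ∀ m n : ℤ, ∫ p, v p * cosProd (m * Real.pi) (n * Real.pi) p ∂μΩ = 0) : v = 0 := by
  have hint : Integrable v μΩ := (Lp.memLp v).integrable (by norm_num)
  have hi : ∀ H : C(ℝ × ℝ, ℝ), Integrable (fun p => v p * H p) μΩ := fun H =>
    integrable_mul_of_memLp_two (Lp.memLp v) (memLp_μΩ_of_continuous H.continuous 2)
  have hspan : ∀ H ∈ Submodule.span ℝ (range fun k : ℤ × ℤ => cosMode k.1 k.2),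
      ∫ p, v p * H p ∂μΩ = 0 := by
    intro H hH
    induction hH using Submodule.span_induction with
    | mem H hH => obtain ⟨k, rfl⟩ := hH; exact h k.1 k.2
    | zero => simp
    | add H H' _ _ h1 h2 =>
      simp only [ContinuousMap.add_apply, mul_add]
      rw [integral_add (hi H) (hi H'), h1, h2, add_zero]
    | smul c H _ h1 =>
      simp only [ContinuousMap.smul_apply, smul_eq_mul, mul_left_comm _ c]
      rw [integral_const_mul, h1, mul_zero]
  rw [Lp.eq_zero_iff_ae_eq_zero]
  refine ae_eq_zero_of_integral_contDiff_smul_eq_zero hint.locallyIntegrable fun ψ hψ _ => ?_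
  have hiψ : Integrable (fun p => v p * ψ p) μΩ := hi ⟨ψ, hψ.continuous⟩
  have hbound : ∀ ε > 0, |∫ p, v p * ψ p ∂μΩ| ≤ ε * ∫ p, |v p| ∂μΩ := by
    intro ε hε
    obtain ⟨H, hH, hnear⟩ := exists_mem_adjoin_near ⟨ψ, hψ.continuous⟩ hε
    have e : ∫ p, v p * ψ p ∂μΩ = - ∫ p, v p * (H p - ψ p) ∂μΩ := by
      simp only [mul_sub]
      rw [integral_sub (hi H) hiψ, hspan H (adjoin_le_span_cosMode hH)]
      simp
    rw [e, abs_neg, ← integral_const_mul]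
    refine (abs_integral_le_integral_abs).trans (integral_mono_ae
      (by simpa only [mul_sub] using ((hi H).sub' hiψ).abs)
      (hint.abs.const_mul ε) ?_)
    filter_upwards [ae_restrict_mem (measurableSet_Ioo.prod measurableSet_Ioo)] with p hp
    rw [abs_mul, mul_comm]
    exact mul_le_mul_of_nonneg_right
      (hnear p (Set.prod_mono Ioo_subset_Icc_self Ioo_subset_Icc_self hp)).le (abs_nonneg _)
  have hz : |∫ p, v p * ψ p ∂μΩ| ≤ 0 := by
    refine ge_of_tendsto (x := 𝓝[>] (0 : ℝ)) (f := fun ε => ε * ∫ p, |v p| ∂μΩ) ?_ ?_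
    · have : Tendsto (fun ε : ℝ => ε * ∫ p, |v p| ∂μΩ) (𝓝 0) (𝓝 (0 * ∫ p, |v p| ∂μΩ)) :=
        tendsto_id.mul_const _
      rw [zero_mul] at this
      exact this.mono_left nhdsWithin_le_nhds
    · filter_upwards [self_mem_nhdsWithin] with ε hε
      exact hbound ε hε
  simp only [smul_eq_mul, mul_comm (ψ _)]
  exact abs_nonpos_iff.1 hz

theorem continuous_integral_mul_cosProd (v : L2Ω) (b : ℝ) :
    Continuous fun a => ∫ p, v p * cosProd a b p ∂μΩ := by
  have hint : Integrable v μΩ := (Lp.memLp v).integrable (by norm_num)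
  refine continuous_of_dominated (bound := fun p => |v p|) (fun a =>
    (integrable_mul_of_memLp_two (Lp.memLp v) (memLp_μΩ_of_continuous
      (contDiff_cosProd a b).continuous 2)).aestronglyMeasurable) (fun a => ?_) hint.abs ?_
  · refine Eventually.of_forall fun p => ?_
    rw [norm_mul, Real.norm_eq_abs]
    refine mul_le_of_le_one_right (abs_nonneg _) ?_
    rw [cosProd, Real.norm_eq_abs, abs_mul]
    exact mul_le_one₀ (Real.abs_cos_le_one _) (abs_nonneg _) (Real.abs_cos_le_one _)
  · refine Eventually.of_forall fun p => ?_
    simp only [cosProd]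
    fun_prop

/-! ### Evolution of the cosine coefficients and uniqueness -/

/-- Variation of constants for a functional of a `C¹` curve. -/
theorem MemC1.exp_mul_sub_eq_integral {u : ℝ → L2Ω} (hu : MemC1 u) (L : L2Ω →L[ℝ] ℝ) {l c : ℝ}
    {φ : ℝ → ℝ}
    (h : ∀ᵐ t ∂μI, L (derivWithin u (Icc 0 1) t) = -l * L (u t) + φ t * c) {t : ℝ}
    (ht : t ∈ Icc (0 : ℝ) 1) :
    Real.exp (l * t) * L (u t) - L (u 0) = (∫ s in Ioo 0 t, φ s * Real.exp (l * s)) * c := by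
  have hcont : ContinuousOn u (Icc 0 1) := hu.continuousOn
  have hdcont : ContinuousOn (derivWithin u (Icc 0 1)) (Icc 0 1) :=
    hu.continuousOn_derivWithin (uniqueDiffOn_Icc one_pos) le_rfl
  have hsub : Icc 0 t ⊆ Icc (0 : ℝ) 1 := Icc_subset_Icc_right ht.2
  have hderiv : ∀ s ∈ Ioo 0 t, HasDerivAt (fun s => Real.exp (l * s) * L (u s))
      (Real.exp (l * s) * l * L (u s) + Real.exp (l * s) * L (derivWithin u (Icc 0 1) s)) s := by
    intro s hs
    have h1 : HasDerivAt u (derivWithin u (Icc 0 1) s) s :=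
      ((hu.differentiableOn one_ne_zero) s (hsub (Ioo_subset_Icc_self hs))).hasDerivWithinAt.hasDerivAt
        (Icc_mem_nhds hs.1 (hs.2.trans_le ht.2))
    exact (hasDerivAt_const_mul (x := s) l).exp.mul (L.hasFDerivAt.comp_hasDerivAt s h1)
  have hLu : ContinuousOn (fun s => L (u s)) (Icc 0 t) := L.continuous.comp_continuousOn (hcont.mono hsub)
  have hLd : ContinuousOn (fun s => L (derivWithin u (Icc 0 1) s)) (Icc 0 t) :=
    L.continuous.comp_continuousOn (hdcont.mono hsub)
  have hexp : ContinuousOn (fun s : ℝ => Real.exp (l * s)) (Icc 0 t) := by fun_prop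
  have hftc := intervalIntegral.integral_eq_sub_of_hasDerivAt_of_le ht.1
    (hexp.mul hLu) hderiv (ContinuousOn.intervalIntegrable_of_Icc ht.1
      (((hexp.mul continuousOn_const).mul hLu).add (hexp.mul hLd)))
  rw [Pi.mul_apply, Pi.mul_apply, mul_zero, Real.exp_zero, one_mul] at hftc
  rw [← hftc, intervalIntegral.integral_of_le ht.1, integral_Ioc_eq_integral_Ioo,
    ← integral_mul_const]
  -- The equation holds only almost everywhere, so it enters under the integral, after the
  -- fundamental theorem of calculus has been applied to the `C¹` curve.
  refine setIntegral_congr_ae measurableSet_Ioo ?_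
  filter_upwards [(ae_restrict_iff' measurableSet_Ioo).1 h] with s hs hst
  rw [hs ⟨hst.1, hst.2.trans_le ht.2⟩]
  ring

theorem SolvesSystem.exp_mul_pairing {φ : Lp ℝ 1 μI} {g₀ g₁ f : L2Ω} {u : ℝ → L2Ω}
    (h : SolvesSystem φ g₀ g₁ u f) (hu : MemC1 u) (a : ℝ) {b : ℝ} (hb : Real.sin b = 0) {t : ℝ}
    (ht : t ∈ Icc (0 : ℝ) 1) :
    Real.exp ((a ^ 2 + b ^ 2) * t) * ∫ p, u t p * cosProd a b p ∂μΩ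
      - ∫ p, g₀ p * cosProd a b p ∂μΩ =
      (∫ s in Ioo 0 t, φ s * Real.exp ((a ^ 2 + b ^ 2) * s)) * ∫ p, f p * cosProd a b p ∂μΩ := by
  have hW := (contDiff_cosProd a b).continuous
  simp only [← pairing_apply hW]
  rw [← h.initial]
  refine hu.exp_mul_sub_eq_integral (pairing hW) ?_ ht
  filter_upwards [h.ae_time] with s ⟨v, hv, heq, hl, hr, hbo, hto, hd⟩
  rw [eq_add_of_sub_eq heq, map_add, map_smul, smul_eq_mul, ← hv, pairing_apply hW (laplacian v),
    integral_laplacian_mul_cosProd hl hr hbo hto hd a hb, ← pairing_apply hW, add_comm]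

theorem eq_of_integral_mul_cosProd_eq {v w : L2Ω}
    (h : ∀ m n : ℤ, ∫ p, v p * cosProd (m * Real.pi) (n * Real.pi) p ∂μΩ =
      ∫ p, w p * cosProd (m * Real.pi) (n * Real.pi) p ∂μΩ) : v = w := by
  refine sub_eq_zero.1 (eq_zero_of_integral_mul_cosProd_eq_zero fun m n => ?_)
  have hW := (contDiff_cosProd (m * Real.pi) (n * Real.pi)).continuous
  rw [← pairing_apply hW, map_sub, pairing_apply hW, pairing_apply hW, h m n, sub_self]

theorem cosProd_abs (a b : ℝ) : cosProd |a| b = cosProd a b := by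
  funext p
  rcases abs_choice a with h | h <;> simp [cosProd, h]

/-- The source term is determined by the initial and the final temperature. -/
theorem SolvesSystem.source_unique {φ : Lp ℝ 1 μI} (hφ : φ ≠ 0) {g₀ g₁ f₁ f₂ : L2Ω}
    {u₁ u₂ : ℝ → L2Ω} (hu₁ : MemC1 u₁) (hu₂ : MemC1 u₂) (h₁ : SolvesSystem φ g₀ g₁ u₁ f₁)
    (h₂ : SolvesSystem φ g₀ g₁ u₂ f₂) : f₁ = f₂ := by
  refine eq_of_integral_mul_cosProd_eq fun m n => ?_
  set a := (m : ℝ) * Real.pi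
  set b := (n : ℝ) * Real.pi
  have hb : Real.sin b = 0 := Real.sin_int_mul_pi n
  set c : ℝ → ℝ := fun x => ∫ p, f₁ p * cosProd x b p ∂μΩ - ∫ p, f₂ p * cosProd x b p ∂μΩ with hc
  -- At `t = 1` the left sides for the two solutions involve only `g₀` and `g₁`, hence coincide.
  have hprod : ∀ x, (∫ s, φ s * Real.exp ((x ^ 2 + b ^ 2) * s) ∂μI) * c x = 0 := by
    intro x
    have e₁ := h₁.exp_mul_pairing hu₁ x hb (right_mem_Icc.2 zero_le_one)
    have e₂ := h₂.exp_mul_pairing hu₂ x hb (right_mem_Icc.2 zero_le_one)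
    rw [h₁.final] at e₁
    rw [h₂.final] at e₂
    rw [hc, mul_sub, ← e₁, ← e₂, sub_self]
  by_contra hne
  have hca : c a ≠ 0 := sub_ne_zero.2 hne
  -- The rate `s = x ^ 2 + b ^ 2` becomes the variable, with `x = √(s - b ^ 2)`. At `s = a ^ 2 + b ^
  -- 2` this gives `|a|`, which is harmless since the cosine is even.
  have hcont : Continuous fun s => c √(s - b ^ 2) :=
    ((continuous_integral_mul_cosProd f₁ b).sub (continuous_integral_mul_cosProd f₂ b)).comp
      (by fun_prop : Continuous fun s => √(s - b ^ 2))
  have hat : c √(a ^ 2 + b ^ 2 - b ^ 2) ≠ 0 := by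
    rw [add_sub_cancel_right, Real.sqrt_sq_eq_abs]
    simp only [hc, cosProd_abs]
    exact hca
  refine hφ ((Lp.eq_zero_iff_ae_eq_zero).2 (ae_eq_zero_of_integral_mul_exp_eq_zero
    (s₀ := a ^ 2 + b ^ 2) (L1.integrable_coeFn φ) ?_))
  -- Approaching from the right keeps `s - b ^ 2` nonnegative, even when `a = 0`.
  filter_upwards [nhdsWithin_le_nhds (hcont.continuousAt.eventually_ne hat), self_mem_nhdsWithin]
    with s hs hgt
  have hle : 0 ≤ s - b ^ 2 := by
    have : a ^ 2 + b ^ 2 < s := hgt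
    nlinarith [sq_nonneg a]
  have := (mul_eq_zero.1 (hprod √(s - b ^ 2))).resolve_right hs
  rwa [Real.sq_sqrt hle, sub_add_cancel] at this

/-- The temperature is determined by its initial value and the source term. -/
theorem SolvesSystem.temperature_unique {φ : Lp ℝ 1 μI} {g₀ g₁ f : L2Ω} {u₁ u₂ : ℝ → L2Ω}
    (hu₁ : MemC1 u₁) (hu₂ : MemC1 u₂) (h₁ : SolvesSystem φ g₀ g₁ u₁ f)
    (h₂ : SolvesSystem φ g₀ g₁ u₂ f) {t : ℝ} (ht : t ∈ Icc (0 : ℝ) 1) : u₁ t = u₂ t := by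
  refine eq_of_integral_mul_cosProd_eq fun m n => ?_
  have e₁ := h₁.exp_mul_pairing hu₁ (m * Real.pi) (Real.sin_int_mul_pi n) ht
  have e₂ := h₂.exp_mul_pairing hu₂ (m * Real.pi) (Real.sin_int_mul_pi n) ht
  exact mul_left_cancel₀ (Real.exp_pos _).ne' (sub_left_injective (e₁.trans e₂.symm))

end HeatSource
end

theorem theorem1 (φ : MeasureTheory.Lp ℝ 1 HeatSource.μI) (hφ : φ ≠ 0)
    (g₀ g₁ : HeatSource.L2Ω)
    (u₁ u₂ : ℝ → HeatSource.L2Ω) (f₁ f₂ : HeatSource.L2Ω)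
    (hu₁ : HeatSource.MemC1 u₁) (hu₁' : HeatSource.MemL2H2 u₁)
    (hu₂ : HeatSource.MemC1 u₂) (hu₂' : HeatSource.MemL2H2 u₂)
    (h₁ : HeatSource.SolvesSystem φ g₀ g₁ u₁ f₁)
    (h₂ : HeatSource.SolvesSystem φ g₀ g₁ u₂ f₂) :
    (∀ t ∈ Set.Icc (0 : ℝ) 1, u₁ t = u₂ t) ∧ f₁ = f₂ := by
  obtain rfl : f₁ = f₂ := h₁.source_unique hφ hu₁ hu₂ h₂
  exact ⟨fun t ht => h₁.temperature_unique hu₁ hu₂ h₂ ht, rfl⟩
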